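/- Let $X_1,X_2,\dots$ be i.i.d. real random variables such that $E|X_1|^3<\infty$ and $X_1$ is discrete (almost surely in a countable set) and non-lattice (there are no $a\in\mathbb{R}$, $h>0$ with $X_1\in a+h\mathbb{Z}$ almost surely; in particular $X_1$ is not almost surely constant). Let $\sigma^2=\mathrm{Var}(X_1)$, $\sigma>0$, and $Y_n=\frac1n\sum_{i=1}^n X_i$. For integers $1\le k<n$ let $F_+$ and $F_-$ denote the distribution functions of $Y_{n+k}-Y_n$ and $Y_{n-k}-Y_n$ respectively. Let $\alpha\in(2/3,1)$ and let $k=k(n)$ be positive integers with $k\sim n^\alpha$, i.e. $k(n)/n^\alpha\to1$ as $n\to\infty$. Then, as $n\to\infty$, \[ F_+\!\left(\frac{\sqrt{k}\,\sigma x}{n}\right)-F_-\!\left(\frac{\sqrt{k}\,\sigma x}{n}\right)=\frac{x\,e^{-x^2/2}}{\sqrt{2\pi}}\,\frac{k}{n}+o\!\left(\frac{k}{n}\right) \] uniformly in $x\in\mathbb{R}$. -/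

import Mathlib

open MeasureTheory ProbabilityTheory Filter Asymptotics
open scoped Topology

/-- A real random variable is discrete if it almost surely takes its values in a countable set. -/
def IsDiscreteRV {Ω : Type*} [MeasurableSpace Ω] (X : Ω → ℝ) (P : Measure Ω) : Prop :=
  ∃ S : Set ℝ, S.Countable ∧ ∀ᵐ ω ∂P, X ω ∈ S

/-- A real random variable is lattice if it almost surely takes its values in some arithmetic
progression `a + hℤ` with span `h > 0`. (Almost surely constant variables are lattice.) -/
def IsLatticeRV {Ω : Type*} [MeasurableSpace Ω] (X : Ω → ℝ) (P : Measure Ω) : Prop :=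
  ∃ a h : ℝ, 0 < h ∧ ∀ᵐ ω ∂P, ∃ m : ℤ, X ω = a + m * h

/-- The mean of the first `n` terms of the sequence; the sequence is indexed from `0`. -/
noncomputable def sampleMean {Ω : Type*} (X : ℕ → Ω → ℝ) (n : ℕ) (ω : Ω) : ℝ :=
  (1 / (n : ℝ)) * ∑ i ∈ Finset.range n, X i ω

/-- The change of the sample mean when `k` observations are added. -/
noncomputable def deltaPlus {Ω : Type*} (X : ℕ → Ω → ℝ) (n k : ℕ) (ω : Ω) : ℝ :=
  sampleMean X (n + k) ω - sampleMean X n ω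

/-- The change of the sample mean when the last `k` observations are removed
(meaningful for `k < n`). -/
noncomputable def deltaMinus {Ω : Type*} (X : ℕ → Ω → ℝ) (n k : ℕ) (ω : Ω) : ℝ :=
  sampleMean X (n - k) ω - sampleMean X n ω

/-- The distribution function of the change of the sample mean when `k` observations are added. -/
noncomputable def FPlus {Ω : Type*} [MeasurableSpace Ω] (P : Measure Ω) (X : ℕ → Ω → ℝ)
    (n k : ℕ) (y : ℝ) : ℝ :=
  cdf (P.map (deltaPlus X n k)) y

/-- The distribution function of the change of the sample mean when `k` observations are
removed. -/
noncomputable def FMinus {Ω : Type*} [MeasurableSpace Ω] (P : Measure Ω) (X : ℕ → Ω → ℝ)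
    (n k : ℕ) (y : ℝ) : ℝ :=
  cdf (P.map (deltaMinus X n k)) y

/-! Multiplied by `n + k`, the increment `deltaPlus` is the sum of the `k` new centred observations
minus `k / n` times the sum of the `n` old ones; its variance is `σ² k (1 + k / n)`. With `N = n -
k`, `n` times `deltaMinus` is `k / N` times the retained centred sum minus the removed one, with
variance `σ² k n / N`. After standardisation the normal approximations of the two distribution
functions at `√k σ x / n` are `Φ(√(1 + h) x)` and `Φ(√(1 - h) x)`, where `h = k / n`. Their
difference is `x e^{-x²/2} / √(2π) · h + O(h²)` uniformly in `x`
(`abs_cdf_stdGaussian_scale_sub_le`).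

The error of each normal approximation is `O(1 / √k)`, by a Berry–Esseen bound for sums with two
weights (`exists_berry_esseen_two_groups`). Since `k ^ (3/2) / n → ∞` exactly when `α > 2/3`, this
error is `o(k / n)`; and `h² = o(h)` because `α < 1`. Non-latticeness enters through `σ > 0`.

The Berry–Esseen bound rests on Esseen's smoothing inequality (`abs_cdf_sub_cdf_le`). Averages of a
difference of distribution functions against a Fejér kernel are controlled by the characteristic
functions on `[-T, T]`. Conversely a large difference persists on an interval, as one function is
monotone and the other Lipschitz, so some average is large too. -/

/-! ### Fourier transform of a difference of distribution functions. -/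

/-- The signed indicator of the interval between `0` and `y`. -/
noncomputable def signedInd (y s : ℝ) : ℝ :=
  (if 0 ≤ s then 1 else 0) - (if y ≤ s then 1 else 0)

lemma measurable_signedInd : Measurable (fun p : ℝ × ℝ => signedInd p.1 p.2) := by
  unfold signedInd
  refine Measurable.sub ?_ ?_
  · exact Measurable.ite (measurableSet_le measurable_const measurable_snd) measurable_const
      measurable_const
  · exact Measurable.ite (measurableSet_le measurable_fst measurable_snd) measurable_const
      measurable_const

lemma signedInd_of_nonneg {y : ℝ} (hy : 0 ≤ y) :
    signedInd y = (Set.Ico 0 y).indicator 1 := by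
  ext s
  simp only [signedInd, Set.indicator, Set.mem_Ico, Pi.one_apply]
  split_ifs <;> grind

lemma signedInd_of_nonpos {y : ℝ} (hy : y ≤ 0) :
    signedInd y = -(Set.Ico y 0).indicator 1 := by
  ext s
  simp only [signedInd, Set.indicator, Set.mem_Ico, Pi.one_apply, Pi.neg_apply]
  split_ifs <;> grind

lemma integrable_signedInd_mul {f : ℝ → ℂ} (hf : Continuous f) (y : ℝ) :
    Integrable (fun s => (signedInd y s : ℂ) * f s) := by
  have key (a b : ℝ) : Integrable ((Set.Ico a b).indicator f) :=
    ((hf.integrableOn_Icc (a := a) (b := b)).mono_set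
      Set.Ico_subset_Icc_self).integrable_indicator measurableSet_Ico
  rcases le_total 0 y with hy | hy
  · rw [signedInd_of_nonneg hy]
    refine (key 0 y).congr (ae_of_all _ fun s => ?_)
    by_cases h : s ∈ Set.Ico 0 y <;> simp [h]
  · rw [signedInd_of_nonpos hy]
    refine (key y 0).neg.congr (ae_of_all _ fun s => ?_)
    by_cases h : s ∈ Set.Ico y 0 <;> simp [h]

lemma integral_signedInd_mul (f : ℝ → ℂ) (y : ℝ) :
    ∫ s, (signedInd y s : ℂ) * f s = ∫ s in (0 : ℝ)..y, f s := by
  have key (a b : ℝ) (hab : a ≤ b) :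
      ∫ s, (Set.Ico a b).indicator f s = ∫ s in a..b, f s := by
    rw [integral_indicator measurableSet_Ico, intervalIntegral.integral_of_le hab,
      integral_Ico_eq_integral_Ioc]
  rcases le_total 0 y with hy | hy
  · rw [signedInd_of_nonneg hy, ← key 0 y hy]
    congr 1 with s
    by_cases h : s ∈ Set.Ico 0 y <;> simp [h]
  · rw [signedInd_of_nonpos hy, intervalIntegral.integral_symm, ← key y 0 hy, ← integral_neg]
    congr 1 with s
    by_cases h : s ∈ Set.Ico y 0 <;> simp [h]

/-- This is why a finite first moment suffices for Fubini in `integrable_signedInd_prod`. -/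
lemma integral_abs_signedInd (y : ℝ) : ∫ s, |signedInd y s| = |y| := by
  rcases le_total 0 y with hy | hy
  · rw [signedInd_of_nonneg hy, abs_of_nonneg hy]
    have : (fun s => |(Set.Ico 0 y).indicator (1 : ℝ → ℝ) s|) = (Set.Ico 0 y).indicator 1 := by
      ext s; by_cases h : s ∈ Set.Ico 0 y <;> simp [h]
    rw [this, integral_indicator_one measurableSet_Ico]
    simp [hy]
  · rw [signedInd_of_nonpos hy, abs_of_nonpos hy]
    have : (fun s => |(-(Set.Ico y 0).indicator (1 : ℝ → ℝ)) s|) = (Set.Ico y 0).indicator 1 := by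
      ext s; by_cases h : s ∈ Set.Ico y 0 <;> simp [h]
    rw [this, integral_indicator_one measurableSet_Ico]
    simp [hy]

/-- Averaging over `y` turns signed indicators into the distribution function corrected by a unit
step at `0`, which makes it integrable on the line. -/
lemma integral_signedInd_measure (μ : Measure ℝ) [IsProbabilityMeasure μ] (s : ℝ) :
    ∫ y, signedInd y s ∂μ = (if 0 ≤ s then 1 else 0) - cdf μ s := by
  unfold signedInd
  have h : (fun y : ℝ => (if y ≤ s then (1 : ℝ) else 0)) = (Set.Iic s).indicator 1 := by
    ext y; simp [Set.indicator]
  rw [integral_sub (integrable_const _), h, integral_indicator_one measurableSet_Iic,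
    cdf_eq_real]
  · simp
  · rw [h]; exact (integrable_const (1 : ℝ)).indicator measurableSet_Iic

lemma integrable_signedInd_prod {μ : Measure ℝ} [IsProbabilityMeasure μ]
    (hμ : Integrable id μ) {f : ℝ → ℂ} (hf : Continuous f) (hb : ∀ s, ‖f s‖ = 1) :
    Integrable (fun p : ℝ × ℝ => (signedInd p.1 p.2 : ℂ) * f p.2) (μ.prod volume) := by
  have hm : AEStronglyMeasurable (fun p : ℝ × ℝ => (signedInd p.1 p.2 : ℂ) * f p.2)
      (μ.prod volume) := by
    have := measurable_signedInd
    have h2 : Measurable fun p : ℝ × ℝ => f p.2 := hf.measurable.comp measurable_snd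
    exact ((Complex.measurable_ofReal.comp this).mul h2).aestronglyMeasurable
  rw [integrable_prod_iff hm]
  refine ⟨ae_of_all _ fun y => integrable_signedInd_mul hf y, ?_⟩
  refine hμ.abs.congr (ae_of_all _ fun y => ?_)
  simp [hb, integral_abs_signedInd]

/-- The integration by parts formula for the characteristic function. -/
lemma charFun_sub_one {μ : Measure ℝ} [IsProbabilityMeasure μ] (hμ : Integrable id μ) (t : ℝ) :
    charFun μ t - 1 = Complex.I * t *
      ∫ s : ℝ, (((if 0 ≤ s then 1 else 0) - cdf μ s : ℝ) : ℂ) * Complex.exp (t * s * Complex.I) := by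
  have hf : Continuous fun s : ℝ => Complex.exp (t * s * Complex.I) := by fun_prop
  have hb (s : ℝ) : ‖Complex.exp (t * s * Complex.I)‖ = 1 := by
    rw [← Complex.ofReal_mul, Complex.norm_exp_ofReal_mul_I]
  have hint := integrable_signedInd_prod hμ hf hb
  have h1 : ∀ s : ℝ, (((if 0 ≤ s then 1 else 0) - cdf μ s : ℝ) : ℂ) * Complex.exp (t * s * Complex.I)
      = ∫ y, (signedInd y s : ℂ) * Complex.exp (t * s * Complex.I) ∂μ := by
    intro s
    rw [integral_mul_const, integral_complex_ofReal, integral_signedInd_measure]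
  simp_rw [h1]
  rw [← integral_integral_swap hint, ← integral_const_mul]
  have h2 : ∀ y : ℝ, Complex.I * t * ∫ s, (signedInd y s : ℂ) * Complex.exp (t * s * Complex.I)
      = Complex.exp (t * y * Complex.I) - 1 := by
    intro y
    rw [integral_signedInd_mul]
    rcases eq_or_ne t 0 with rfl | ht
    · simp
    · have hc : (t * Complex.I : ℂ) ≠ 0 := by simp [ht]
      have : (fun s : ℝ => Complex.exp (t * s * Complex.I))
          = fun s : ℝ => Complex.exp ((t * Complex.I) * s) := by ext s; congr 1; ring
      rw [this, integral_exp_mul_complex hc]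
      simp only [Complex.ofReal_zero, mul_zero, Complex.exp_zero]
      rw [mul_comm Complex.I, mul_div_cancel₀ _ hc]
      congr 2; ring
  simp_rw [h2]
  rw [charFun_apply_real, integral_sub, integral_const]
  · simp
  · refine (integrable_const (1 : ℝ)).mono' (by fun_prop) (ae_of_all _ fun y => ?_)
    rw [← Complex.ofReal_mul, Complex.norm_exp_ofReal_mul_I]
  · exact integrable_const _

lemma integrable_ind_sub_cdf {μ : Measure ℝ} [IsProbabilityMeasure μ] (hμ : Integrable id μ) :
    Integrable fun s : ℝ => (if 0 ≤ s then 1 else 0) - cdf μ s := by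
  have := (integrable_signedInd_prod hμ (f := fun _ => 1) continuous_const
    (by simp)).integral_prod_right
  simp only [mul_one, integral_complex_ofReal] at this
  have := this.re
  simpa [integral_signedInd_measure] using this

lemma integrable_cdf_sub_cdf {μ ν : Measure ℝ} [IsProbabilityMeasure μ] [IsProbabilityMeasure ν]
    (hμ : Integrable id μ) (hν : Integrable id ν) :
    Integrable fun s : ℝ => cdf μ s - cdf ν s := by
  refine ((integrable_ind_sub_cdf hν).sub (integrable_ind_sub_cdf hμ)).congr
    (ae_of_all _ fun s => ?_)
  simp

lemma Integrable.mul_exp_I {f : ℝ → ℝ} (hf : Integrable f) (t : ℝ) :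
    Integrable fun s : ℝ => (f s : ℂ) * Complex.exp (t * s * Complex.I) := by
  refine hf.ofReal.mul_bdd (c := 1) (by fun_prop) (ae_of_all _ fun s => ?_)
  rw [← Complex.ofReal_mul, Complex.norm_exp_ofReal_mul_I]

/-- The unit steps cancel. Division by `t` then expresses the Fourier transform of the difference of
distribution functions through characteristic functions. -/
lemma charFun_sub_charFun {μ ν : Measure ℝ} [IsProbabilityMeasure μ] [IsProbabilityMeasure ν]
    (hμ : Integrable id μ) (hν : Integrable id ν) (t : ℝ) :
    charFun μ t - charFun ν t = -(Complex.I * t *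
      ∫ s : ℝ, ((cdf μ s - cdf ν s : ℝ) : ℂ) * Complex.exp (t * s * Complex.I)) := by
  have h1 := charFun_sub_one hμ t
  have h2 := charFun_sub_one hν t
  have : charFun μ t - charFun ν t = (charFun μ t - 1) - (charFun ν t - 1) := by ring
  rw [this, h1, h2, ← mul_sub, ← integral_sub (Integrable.mul_exp_I (integrable_ind_sub_cdf hμ) t)
    (Integrable.mul_exp_I (integrable_ind_sub_cdf hν) t), ← mul_neg, ← integral_neg]
  congr 2 with s
  push_cast
  ring

/-! ### The Fejér kernel: size, concentration and averages. -/

/-- The Fejér kernel. -/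
noncomputable def fejer (T u : ℝ) : ℝ := ∫ t in (-T)..T, (1 - |t| / T) * Real.cos (t * u)

/-- Integration by parts against the triangle weight. The point `u = 0` is excluded because the
right side is then `0` by the convention on division, whereas the kernel equals `T` there. -/
lemma fejer_eq {T u : ℝ} (hT : 0 < T) (hu : u ≠ 0) :
    fejer T u = 2 * (1 - Real.cos (T * u)) / (T * u ^ 2) := by
  have hc : Continuous fun t : ℝ => (1 - |t| / T) * Real.cos (t * u) := by fun_prop
  have hhalf : ∫ t in (0 : ℝ)..T, (1 - |t| / T) * Real.cos (t * u)
      = (1 - Real.cos (T * u)) / (T * u ^ 2) := by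
    have h1 : ∫ t in (0 : ℝ)..T, (1 - |t| / T) * Real.cos (t * u)
        = ∫ t in (0 : ℝ)..T, (1 - t / T) * Real.cos (t * u) := by
      refine intervalIntegral.integral_congr fun t ht => ?_
      rw [Set.uIcc_of_le hT.le] at ht
      simp only [abs_of_nonneg ht.1]
    rw [h1, intervalIntegral.integral_eq_sub_of_hasDerivAt
      (f := fun t => (1 - t / T) * (Real.sin (t * u) / u) - Real.cos (t * u) / (T * u ^ 2))]
    · simp
      field_simp
      ring
    · intro t _
      have hs : HasDerivAt (fun t : ℝ => t * u) u t := by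
        simpa using (hasDerivAt_id t).mul_const u
      have h2 : HasDerivAt (fun t : ℝ => 1 - t / T) (-(1 / T)) t := by
        simpa using ((hasDerivAt_id t).div_const T).const_sub 1
      convert! (h2.mul (hs.sin.div_const u)).sub (hs.cos.div_const (T * u ^ 2)) using 1
      field_simp
      ring
    · exact Continuous.intervalIntegrable (by fun_prop) _ _
  have hneg : ∫ t in (-T)..0, (1 - |t| / T) * Real.cos (t * u)
      = ∫ t in (0 : ℝ)..T, (1 - |t| / T) * Real.cos (t * u) := by
    have := intervalIntegral.integral_comp_neg (a := 0) (b := T)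
      (fun t => (1 - |t| / T) * Real.cos (t * u))
    simp only [neg_zero] at this
    rw [← this]
    simp
  rw [fejer, ← intervalIntegral.integral_add_adjacent_intervals (b := 0)
    (hc.intervalIntegrable _ _) (hc.intervalIntegrable _ _), hneg, hhalf]
  ring

lemma fejer_zero_nonneg {T : ℝ} (hT : 0 < T) : 0 ≤ fejer T 0 := by
  refine intervalIntegral.integral_nonneg (by linarith) fun t ht => ?_
  have : |t| / T ≤ 1 := by rw [div_le_one hT]; exact abs_le.2 ht
  simpa using this

lemma fejer_nonneg {T : ℝ} (hT : 0 < T) (u : ℝ) : 0 ≤ fejer T u := by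
  rcases eq_or_ne u 0 with rfl | hu
  · exact fejer_zero_nonneg hT
  rw [fejer_eq hT hu]
  have := Real.cos_le_one (T * u)
  have : 0 ≤ 1 - Real.cos (T * u) := by linarith
  positivity

lemma fejer_le {T u : ℝ} (hT : 0 < T) (hu : u ≠ 0) : fejer T u ≤ 4 / (T * u ^ 2) := by
  rw [fejer_eq hT hu]
  have := Real.neg_one_le_cos (T * u)
  gcongr
  linarith

lemma le_fejer {T u : ℝ} (hT : 0 < T) (hu : u ≠ 0) (h : |u| ≤ 1 / T) :
    2 / 5 * T ≤ fejer T u := by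
  rw [fejer_eq hT hu]
  have h1 : |T * u| ≤ 1 := by
    rw [abs_mul, abs_of_pos hT]
    rw [le_div_iff₀ hT] at h
    linarith
  have h2 := Real.cos_le_one_sub_mul_cos_sq (x := T * u) (h1.trans (by linarith [Real.pi_gt_three]))
  -- This is `π² ≤ 10`, used in `cos y ≤ 1 - (2 / π²) y²`.
  have hpi : 1 / 5 ≤ 2 / Real.pi ^ 2 := by
    rw [div_le_div_iff₀ (by norm_num) (by positivity)]
    nlinarith [Real.pi_lt_d2, Real.pi_pos]
  rw [le_div_iff₀ (by positivity)]
  nlinarith [mul_le_mul_of_nonneg_right hpi (sq_nonneg (T * u))]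

/-- A bounded-band average of an integrable function is controlled by its Fourier transform. -/
lemma norm_integral_mul_fejer_le {f : ℝ → ℝ} (hf : Integrable f) {T : ℝ} (hT : 0 < T)
    {B : ℝ → ℝ} (hB : IntervalIntegrable B volume (-T) T)
    (h : ∀ t, |t| ≤ T → t ≠ 0 → ‖∫ s : ℝ, (f s : ℂ) * Complex.exp (t * s * Complex.I)‖ ≤ B t)
    (x : ℝ) : |∫ s, f s * fejer T (s - x)| ≤ ∫ t in (-T)..T, B t := by
  have hTT : -T ≤ T := by linarith
  let w : ℝ → ℝ := fun t => 1 - |t| / T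
  have hw (t : ℝ) (ht : |t| ≤ T) : |w t| ≤ 1 := by
    have h1 : |t| / T ≤ 1 := by rwa [div_le_one hT]
    have h2 : 0 ≤ |t| / T := by positivity
    rw [abs_le]; constructor <;> simp only [w] <;> linarith
  let ρ : Measure ℝ := volume.restrict (Set.Ioc (-T) T)
  have hbase : Integrable (fun p : ℝ × ℝ => f p.1 * 1) (volume.prod ρ) :=
    hf.mul_prod (μ := volume) (ν := ρ) (integrable_const (1 : ℝ))
  have hae : ∀ᵐ p : ℝ × ℝ ∂(volume.prod ρ), |p.2| ≤ T := by
    have : ∀ᵐ t ∂ρ, |t| ≤ T := by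
      filter_upwards [ae_restrict_mem measurableSet_Ioc] with t ht
      exact abs_le.2 ⟨ht.1.le, ht.2⟩
    exact Measure.quasiMeasurePreserving_snd.ae this
  have hint : Integrable (fun p : ℝ × ℝ => f p.1 * (w p.2 * Real.cos (p.2 * (p.1 - x))))
      (volume.prod ρ) := by
    simp only [mul_one] at hbase
    refine hbase.mul_bdd (c := 1) (by fun_prop) ?_
    filter_upwards [hae] with p hp
    rw [norm_mul]
    exact mul_le_one₀ (hw _ hp) (norm_nonneg _) (Real.abs_cos_le_one _)
  have h1 : ∫ s, f s * fejer T (s - x)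
      = ∫ t in (-T)..T, w t * ∫ s, f s * Real.cos (t * (s - x)) := by
    have : ∀ s, f s * fejer T (s - x) = ∫ t, f s * (w t * Real.cos (t * (s - x))) ∂ρ := by
      intro s
      rw [integral_const_mul, fejer, intervalIntegral.integral_of_le hTT]
    simp_rw [this]
    rw [integral_integral_swap hint, intervalIntegral.integral_of_le hTT]
    refine integral_congr_ae (ae_of_all _ fun t => ?_)
    simp only
    rw [← integral_const_mul]
    congr 1 with s
    ring
  rw [h1, ← Real.norm_eq_abs]
  refine intervalIntegral.norm_integral_le_of_norm_le hTT ?_ hB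
  -- The bound on the transform comes from division by `|t|`, so it is assumed only off this null
  -- set.
  have h0 : ∀ᵐ t : ℝ, t ≠ 0 := by
    simp [ae_iff]
  filter_upwards [h0] with t ht0 ht
  have htT : |t| ≤ T := abs_le.2 ⟨ht.1.le, ht.2⟩
  rw [norm_mul]
  refine (mul_le_of_le_one_left (norm_nonneg _) (hw t htT)).trans (le_trans ?_ (h t htT ht0))
  have h2 : ∫ s, f s * Real.cos (t * (s - x))
      = (Complex.exp (-(t * x * Complex.I)) *
        ∫ s : ℝ, (f s : ℂ) * Complex.exp (t * s * Complex.I)).re := by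
    rw [← integral_const_mul]
    have hi : Integrable fun s : ℝ => Complex.exp (-(t * x * Complex.I)) *
      ((f s : ℂ) * Complex.exp (t * s * Complex.I)) := (Integrable.mul_exp_I hf t).const_mul _
    have := integral_re hi
    simp only [RCLike.re_eq_complex_re] at this
    rw [← this]
    congr 1 with s
    rw [mul_left_comm, ← Complex.exp_add, Complex.re_ofReal_mul]
    congr 1
    rw [show (-(t * x * Complex.I) + t * s * Complex.I : ℂ) = ((t * (s - x) : ℝ) : ℂ) * Complex.I by
      push_cast; ring, Complex.exp_ofReal_mul_I_re]
  rw [h2, Real.norm_eq_abs]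
  refine (Complex.abs_re_le_norm _).trans ?_
  rw [norm_mul, show (-(t * x * Complex.I) : ℂ) = ((-(t * x) : ℝ) : ℂ) * Complex.I by
      push_cast; ring, Complex.norm_exp_ofReal_mul_I, one_mul]

lemma aestronglyMeasurable_fejer {T : ℝ} (hT : 0 < T) : AEStronglyMeasurable (fejer T) := by
  have hm : Measurable fun u : ℝ => 2 * (1 - Real.cos (T * u)) / (T * u ^ 2) := by fun_prop
  refine hm.aestronglyMeasurable.congr ?_
  have h0 : ∀ᵐ t : ℝ, t ≠ 0 := by simp [ae_iff]
  filter_upwards [h0] with u hu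
  rw [fejer_eq hT hu]

lemma abs_fejer_le {T : ℝ} (hT : 0 < T) (u : ℝ) : |fejer T u| ≤ 2 * T := by
  have := intervalIntegral.norm_integral_le_of_norm_le_const (a := -T) (b := T) (C := 1)
    (f := fun t => (1 - |t| / T) * Real.cos (t * u)) (fun t ht => ?_)
  · rw [show T - -T = 2 * T by ring, abs_of_pos (by positivity), one_mul] at this
    exact this
  · rw [Set.uIoc_of_le (by linarith)] at ht
    have h1 : |t| / T ≤ 1 := by
      rw [div_le_one hT]; exact abs_le.2 ⟨ht.1.le, ht.2⟩
    have h2 : 0 ≤ |t| / T := by positivity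
    rw [norm_mul]
    refine mul_le_one₀ ?_ (norm_nonneg _) (Real.abs_cos_le_one _)
    rw [Real.norm_eq_abs, abs_le]
    constructor <;> linarith

/-- The kernel has a fixed mass within `1 / T` of its centre, where `f ≥ η / 2`, and a tail of mass
`O(1 / (T h))` beyond distance `h`, where only `f ≥ -η` is known. Once `T h` is large the centre
wins. -/
lemma le_integral_mul_fejer {f : ℝ → ℝ} (hf : Integrable f) {T h η x : ℝ} (hT : 0 < T)
    (hh : 0 < h) (hTh : 130 ≤ T * h) (hη : ∀ s, |f s| ≤ η)
    (hlow : ∀ s, |s - x| ≤ h → η / 2 ≤ f s) :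
    η / 5 ≤ ∫ s, f s * fejer T (s - x) := by
  have hη0 : 0 ≤ η := (abs_nonneg _).trans (hη 0)
  -- An explicit integrable minorant: the central block has integral `2η / 5`, and the Cauchy
  -- profile, which dominates the tail bound `4 / (T u²)` for `|u| > h`, has integral `8πη / (T h)`.
  -- The threshold `130 > 40π` keeps the latter below `η / 5`.
  let g : ℝ → ℝ := fun u => η * (T / 5) * (Set.Icc (-(1 / T)) (1 / T)).indicator 1 u
    - η * (8 / (T * h ^ 2)) * (1 + (u / h) ^ 2)⁻¹
  have hi1 : Integrable fun u : ℝ =>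
      η * (T / 5) * (Set.Icc (-(1 / T)) (1 / T)).indicator (1 : ℝ → ℝ) u :=
    ((integrable_indicator_iff measurableSet_Icc).2
      (integrableOn_const (C := (1 : ℝ)) (by simp))).const_mul _
  have hi2 : Integrable fun u : ℝ => η * (8 / (T * h ^ 2)) * (1 + (u / h) ^ 2)⁻¹ :=
    (integrable_inv_one_add_sq.comp_div hh.ne').const_mul _
  have hg : Integrable g := hi1.sub hi2
  have hgint : ∫ u, g u = η * (2 / 5) - η * (8 * Real.pi / (T * h)) := by
    rw [integral_sub hi1 hi2, integral_const_mul, integral_const_mul,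
      integral_indicator_one measurableSet_Icc,
      Measure.integral_comp_div (fun u => (1 + u ^ 2)⁻¹) h, integral_univ_inv_one_add_sq]
    rw [Real.volume_real_Icc_of_le (by have : 0 < 1 / T := by positivity
                                       linarith), abs_of_pos hh, smul_eq_mul]
    field_simp
    ring
  have h2 : η / 5 ≤ ∫ u, g u := by
    rw [hgint]
    have : 8 * Real.pi / (T * h) ≤ 1 / 5 := by
      rw [div_le_div_iff₀ (by positivity) (by norm_num)]
      nlinarith [Real.pi_lt_d2]
    nlinarith
  refine h2.trans ?_
  rw [← integral_sub_right_eq_self g x]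
  have hshift : AEStronglyMeasurable fun s => fejer T (s - x) :=
    (aestronglyMeasurable_fejer hT).comp_measurePreserving (measurePreserving_sub_right volume x)
  refine integral_mono_ae (hg.comp_sub_right x)
    (hf.mul_bdd (c := 2 * T) hshift (ae_of_all _ fun s => abs_fejer_le hT _)) ?_
  have h0 : ∀ᵐ s : ℝ, s ≠ x := by simp [ae_iff]
  filter_upwards [h0] with s hs
  have hu : s - x ≠ 0 := sub_ne_zero.2 hs
  simp only [g]
  have hfn := fejer_nonneg hT (s - x)
  have h1T : 1 / T ≤ h := by rw [div_le_iff₀ hT]; linarith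
  have hpos : 0 ≤ η * (8 / (T * h ^ 2)) * (1 + ((s - x) / h) ^ 2)⁻¹ := by positivity
  by_cases hin : |s - x| ≤ h
  · have hfs := hlow s hin
    by_cases hin' : s - x ∈ Set.Icc (-(1 / T)) (1 / T)
    · rw [Set.indicator_of_mem hin']
      have := le_fejer hT hu (abs_le.2 hin')
      simp only [Pi.one_apply]
      have : η / 2 * (2 / 5 * T) ≤ f s * fejer T (s - x) := by gcongr; linarith
      linarith
    · rw [Set.indicator_of_notMem hin']
      have : 0 ≤ f s * fejer T (s - x) := mul_nonneg (by linarith) hfn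
      linarith
  · have hin' : s - x ∉ Set.Icc (-(1 / T)) (1 / T) := fun hm =>
      hin ((abs_le.2 hm).trans h1T)
    rw [Set.indicator_of_notMem hin']
    have h3 := fejer_le hT hu
    have h4 : 4 / (T * (s - x) ^ 2) ≤ 8 / (T * h ^ 2) * (1 + ((s - x) / h) ^ 2)⁻¹ := by
      have hsq : h ^ 2 ≤ (s - x) ^ 2 := by
        rw [← sq_abs (s - x)]; push Not at hin; gcongr
      have : 8 / (T * h ^ 2) * (1 + ((s - x) / h) ^ 2)⁻¹ = 8 / (T * (h ^ 2 + (s - x) ^ 2)) := by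
        field_simp
      rw [this, div_le_div_iff₀ (by positivity) (by positivity)]
      nlinarith
    have h5 := neg_abs_le (f s)
    have h6 := hη s
    have h7 : -η ≤ f s := by linarith
    have h8 : η * fejer T (s - x) ≤ η * (8 / (T * h ^ 2) * (1 + ((s - x) / h) ^ 2)⁻¹) :=
      mul_le_mul_of_nonneg_left (h3.trans h4) hη0
    have h9 : -η * fejer T (s - x) ≤ f s * fejer T (s - x) := mul_le_mul_of_nonneg_right h7 hfn
    linarith

/-! ### Esseen's smoothing inequality. -/

/-- **Esseen's smoothing inequality**, with unspecified numerical constants. -/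
theorem abs_cdf_sub_cdf_le {μ ν : Measure ℝ} [IsProbabilityMeasure μ] [IsProbabilityMeasure ν]
    (hμ : Integrable id μ) (hν : Integrable id ν) {m T : ℝ} (hm : 0 < m) (hT : 0 < T)
    (hlip : ∀ a b, a ≤ b → cdf ν b - cdf ν a ≤ m * (b - a))
    {B : ℝ → ℝ} (hB : IntervalIntegrable B volume (-T) T)
    (h : ∀ t, |t| ≤ T → ‖charFun μ t - charFun ν t‖ ≤ |t| * B t) (x : ℝ) :
    |cdf μ x - cdf ν x| ≤ 5 * (∫ t in (-T)..T, B t) + 1040 * (m / T) := by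
  let f : ℝ → ℝ := fun s => cdf μ s - cdf ν s
  have hf : Integrable f := integrable_cdf_sub_cdf hμ hν
  have hbound (y : ℝ) : |∫ s, f s * fejer T (s - y)| ≤ ∫ t in (-T)..T, B t := by
    refine norm_integral_mul_fejer_le hf hT hB (fun t ht ht0 => ?_) y
    have h1 := h t ht
    rw [charFun_sub_charFun hμ hν, norm_neg, norm_mul, norm_mul, Complex.norm_I, one_mul,
      Complex.norm_real, Real.norm_eq_abs] at h1
    exact le_of_mul_le_mul_left h1 (abs_pos.2 ht0)
  have hI0 : 0 ≤ ∫ t in (-T)..T, B t := (abs_nonneg _).trans (hbound 0)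
  have hbdd : BddAbove (Set.range fun s => |f s|) := by
    refine ⟨1, ?_⟩
    rintro _ ⟨s, rfl⟩
    have := cdf_nonneg μ s
    have := cdf_nonneg ν s
    have := cdf_le_one μ s
    have := cdf_le_one ν s
    simp only [f, abs_le]
    constructor <;> linarith
  set η : ℝ := ⨆ s, |f s| with hηdef
  have hη (s : ℝ) : |f s| ≤ η := le_ciSup hbdd s
  suffices η ≤ 5 * (∫ t in (-T)..T, B t) + 1040 * (m / T) from (hη x).trans this
  by_cases hsmall : η ≤ 1040 * (m / T)
  · linarith
  push Not at hsmall
  have hη0 : 0 < η := lt_of_le_of_lt (by positivity) hsmall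
  -- Over a length `2d` the Lipschitz function grows by at most `η / 4`, so a value above `3η / 4`
  -- stays above `η / 2`. The constant `1040 = 8 · 130` gives `T d ≥ 130`.
  let d : ℝ := η / (8 * m)
  have hd : 0 < d := by positivity
  have hTd : 130 ≤ T * d := by
    simp only [d]
    rw [← mul_div_assoc, div_lt_iff₀ hT] at hsmall
    rw [← mul_div_assoc, le_div_iff₀ (by positivity)]
    linarith
  have hmd : m * (2 * d) = η / 4 := by simp only [d]; field_simp; ring
  obtain ⟨x₀, hx₀⟩ := exists_lt_of_lt_ciSup (show 3 / 4 * η < ⨆ s, |f s| by rw [← hηdef]; linarith)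
  suffices ∃ y, η / 5 ≤ |∫ s, f s * fejer T (s - y)| by
    obtain ⟨y, hy⟩ := this
    have := hbound y
    have : 0 < m / T := by positivity
    linarith
  -- As `cdf μ` is monotone, a positive excess persists to the right of `x₀` and a negative one to
  -- the left; the kernel is centred accordingly.
  rcases lt_abs.1 hx₀ with hpos | hneg
  · refine ⟨x₀ + d, (le_integral_mul_fejer hf hT hd hTd hη fun s hs => ?_).trans (le_abs_self _)⟩
    rw [abs_le] at hs
    have h1 := hlip x₀ s (by linarith)
    have h2 := monotone_cdf μ (show x₀ ≤ s by linarith)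
    have h3 : m * (s - x₀) ≤ m * (2 * d) := by gcongr; linarith
    simp only [f] at hpos ⊢
    linarith
  · refine ⟨x₀ - d, ?_⟩
    have := le_integral_mul_fejer (f := fun s => -f s) (x := x₀ - d) hf.neg hT hd hTd
      (fun s => by rw [abs_neg]; exact hη s) fun s hs => ?_
    · simp only [neg_mul, integral_neg] at this
      exact this.trans (neg_le_abs _)
    rw [abs_le] at hs
    have h1 := hlip s x₀ (by linarith)
    have h2 := monotone_cdf μ (show s ≤ x₀ by linarith)
    have h3 : m * (x₀ - s) ≤ m * (2 * d) := by gcongr; linarith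
    simp only [f] at hneg ⊢
    linarith

/-! ### Expansion of the characteristic function near the origin. -/

lemma norm_exp_mul_I_sub_taylor_le (u : ℝ) :
    ‖Complex.exp (u * Complex.I) - (1 + u * Complex.I - u ^ 2 / 2)‖ ≤ 4 * |u| ^ 3 := by
  rcases le_total |u| 1 with hu | hu
  · have h := Complex.norm_exp_sub_sum_le_norm_mul_exp (u * Complex.I) 3
    simp only [Finset.sum_range_succ, Finset.range_zero, Finset.sum_empty, norm_mul,
      Complex.norm_I, mul_one, Complex.norm_real, Real.norm_eq_abs] at h
    have h1 : Real.exp |u| ≤ 4 := by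
      have := Real.exp_le_exp.2 hu
      linarith [Real.exp_one_lt_d9]
    have h2 : |u| ^ 3 * Real.exp |u| ≤ |u| ^ 3 * 4 := by gcongr
    have h3 : (1 + u * Complex.I - u ^ 2 / 2 : ℂ) = 0 + (u * Complex.I) ^ 0 / (Nat.factorial 0 : ℕ)
        + (u * Complex.I) ^ 1 / (Nat.factorial 1 : ℕ)
        + (u * Complex.I) ^ 2 / (Nat.factorial 2 : ℕ) := by
      simp [mul_pow, Nat.factorial]
      ring
    rw [h3]
    linarith
  · have h1 : ‖Complex.exp (u * Complex.I)‖ = 1 := Complex.norm_exp_ofReal_mul_I u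
    have h2 : ‖(1 + u * Complex.I - u ^ 2 / 2 : ℂ)‖ ≤ 1 + |u| + |u| ^ 2 / 2 := by
      refine (norm_sub_le _ _).trans (add_le_add ((norm_add_le _ _).trans ?_) ?_)
      · simp
      · simp
    refine (norm_sub_le _ _).trans ?_
    rw [h1]
    nlinarith [mul_nonneg (sub_nonneg.2 hu) (abs_nonneg u), mul_nonneg (sub_nonneg.2 hu) (sq_nonneg |u|)]

section Moments

variable {μ : Measure ℝ} [IsProbabilityMeasure μ]

lemma integrable_id_of_abs_pow_three (h : Integrable (fun y : ℝ => |y| ^ 3) μ) :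
    Integrable id μ := by
  refine ((integrable_const (1 : ℝ)).add h).mono' (by fun_prop) (ae_of_all _ fun y => ?_)
  simp only [id, Real.norm_eq_abs, Pi.add_apply]
  nlinarith [sq_nonneg (|y| - 1), abs_nonneg y, mul_nonneg (abs_nonneg y) (sq_nonneg (|y| - 1))]

lemma integrable_sq_of_abs_pow_three (h : Integrable (fun y : ℝ => |y| ^ 3) μ) :
    Integrable (fun y : ℝ => y ^ 2) μ := by
  refine ((integrable_const (1 : ℝ)).add h).mono' (by fun_prop) (ae_of_all _ fun y => ?_)
  simp only [Real.norm_eq_abs, Pi.add_apply, abs_pow]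
  nlinarith [sq_nonneg (|y| - 1), abs_nonneg y, mul_nonneg (abs_nonneg y) (sq_nonneg (|y| - 1))]

lemma norm_charFun_sub_taylor_le (h : Integrable (fun y : ℝ => |y| ^ 3) μ)
    (hmean : ∫ y, y ∂μ = 0) (t : ℝ) :
    ‖charFun μ t - (1 - (∫ y, y ^ 2 ∂μ : ℝ) * t ^ 2 / 2 : ℝ)‖ ≤ 4 * (∫ y, |y| ^ 3 ∂μ) * |t| ^ 3 := by
  have hi1 : Integrable (fun y : ℝ => (y : ℂ)) μ := (integrable_id_of_abs_pow_three h).ofReal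
  have hi2 : Integrable (fun y : ℝ => ((y ^ 2 : ℝ) : ℂ)) μ :=
    (integrable_sq_of_abs_pow_three h).ofReal
  have he : Integrable (fun y : ℝ => Complex.exp (t * y * Complex.I)) μ := by
    refine (integrable_const (1 : ℝ)).mono' (by fun_prop) (ae_of_all _ fun y => ?_)
    rw [← Complex.ofReal_mul, Complex.norm_exp_ofReal_mul_I]
  have hp0 : Integrable (fun y : ℝ => (1 + (t * Complex.I) * y : ℂ)) μ :=
    (integrable_const _).add (hi1.const_mul _)
  have hp : Integrable (fun y : ℝ => (1 + (t * Complex.I) * y - (t ^ 2 / 2) * (y ^ 2 : ℝ) : ℂ)) μ :=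
    hp0.sub (hi2.const_mul _)
  have heq : charFun μ t - (1 - (∫ y, y ^ 2 ∂μ : ℝ) * t ^ 2 / 2 : ℝ)
      = ∫ y : ℝ, (Complex.exp (t * y * Complex.I) -
          (1 + (t * Complex.I) * y - (t ^ 2 / 2) * (y ^ 2 : ℝ))) ∂μ := by
    rw [integral_sub he hp, integral_sub hp0 (hi2.const_mul _), integral_add (integrable_const _) (hi1.const_mul _), integral_const_mul,
      integral_const_mul, integral_complex_ofReal, integral_complex_ofReal, hmean,
      charFun_apply_real]
    simp
    ring
  rw [heq, mul_right_comm, ← integral_const_mul]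
  refine norm_integral_le_of_norm_le (h.const_mul _) (ae_of_all _ fun y => ?_)
  have := norm_exp_mul_I_sub_taylor_le (t * y)
  rw [abs_mul, mul_pow] at this
  refine le_trans (le_of_eq ?_) (this.trans (le_of_eq (by ring)))
  congr 1
  push_cast
  ring

lemma exists_charFun_bounds (h : Integrable (fun y : ℝ => |y| ^ 3) μ)
    (hmean : ∫ y, y ∂μ = 0) {s : ℝ} (hs : s = ∫ y, y ^ 2 ∂μ) (hs0 : 0 < s) :
    ∃ c A : ℝ, 0 < c ∧ 0 ≤ A ∧ ∀ t, |t| ≤ c →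
      ‖charFun μ t - (Real.exp (-(s * t ^ 2 / 2)) : ℝ)‖ ≤ A * |t| ^ 3 ∧
      ‖charFun μ t‖ ≤ Real.exp (-(s * t ^ 2 / 4)) := by
  set ρ : ℝ := ∫ y, |y| ^ 3 ∂μ with hρ
  have hρ0 : 0 ≤ ρ := integral_nonneg fun y => by positivity
  -- The first two bounds on `c` give `s t² ≤ 1`, so `1 - s t² / 2` is nonnegative; the third makes
  -- the cubic remainder `4ρ|t|³` at most `s t² / 4`, half of the quadratic term. In `A`, `4ρ` is
  -- the Taylor remainder of the characteristic function and `s²` covers that of the Gaussian.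
  refine ⟨min 1 (min (1 / s) (s / (16 * (ρ + 1)))), 4 * ρ + s ^ 2, by positivity, by positivity,
    fun t ht => ?_⟩
  have ht1 : |t| ≤ 1 := ht.trans (min_le_left _ _)
  have ht2 : |t| * s ≤ 1 := by
    rw [← le_div_iff₀ hs0]; exact ht.trans ((min_le_right _ _).trans (min_le_left _ _))
  have ht3 : |t| * (16 * (ρ + 1)) ≤ s := by
    rw [← le_div_iff₀ (by positivity)]
    exact ht.trans ((min_le_right _ _).trans (min_le_right _ _))
  have ht0 := abs_nonneg t
  have hst : s * t ^ 2 ≤ 1 := by rw [← sq_abs]; nlinarith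
  have hst0 : 0 ≤ s * t ^ 2 := by positivity
  have hT := norm_charFun_sub_taylor_le h hmean t
  rw [← hs, ← hρ] at hT
  constructor
  · have hg : ‖((1 - s * t ^ 2 / 2 : ℝ) : ℂ) - (Real.exp (-(s * t ^ 2 / 2)) : ℝ)‖
        ≤ s ^ 2 * |t| ^ 3 := by
      have := Real.abs_exp_sub_one_sub_id_le (x := -(s * t ^ 2 / 2))
        (by rw [abs_neg, abs_of_nonneg (by positivity)]; linarith)
      rw [← Complex.ofReal_sub, Complex.norm_real, Real.norm_eq_abs, abs_sub_comm]
      rw [show Real.exp (-(s * t ^ 2 / 2)) - (1 - s * t ^ 2 / 2)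
        = Real.exp (-(s * t ^ 2 / 2)) - 1 - -(s * t ^ 2 / 2) by ring]
      refine this.trans ?_
      rw [← sq_abs t]
      have : |t| ^ 4 ≤ |t| ^ 3 := pow_le_pow_of_le_one ht0 ht1 (by norm_num)
      have h2 : s ^ 2 * |t| ^ 4 ≤ s ^ 2 * |t| ^ 3 := by gcongr
      have h3 : 0 ≤ s ^ 2 * |t| ^ 4 := by positivity
      nlinarith
    have := norm_sub_le_norm_sub_add_norm_sub (charFun μ t) ((1 - s * t ^ 2 / 2 : ℝ) : ℂ)
      ((Real.exp (-(s * t ^ 2 / 2)) : ℝ) : ℂ)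
    linarith
  · have h1 : ‖((1 - s * t ^ 2 / 2 : ℝ) : ℂ)‖ = 1 - s * t ^ 2 / 2 := by
      rw [Complex.norm_real, Real.norm_eq_abs, abs_of_nonneg (by linarith)]
    have h2 := norm_le_norm_add_norm_sub' (charFun μ t) ((1 - s * t ^ 2 / 2 : ℝ) : ℂ)
    have h3 : 4 * ρ * |t| ^ 3 ≤ s * t ^ 2 / 4 := by
      rw [← sq_abs t]
      have : 0 ≤ |t| ^ 2 := by positivity
      nlinarith
    have h4 := Real.add_one_le_exp (-(s * t ^ 2 / 4))
    linarith

end Moments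

/-! ### Berry–Esseen bound for two groups of summands. -/

lemma norm_pow_sub_pow_le {a b : ℂ} {M : ℝ} (ha : ‖a‖ ≤ M) (hb : ‖b‖ ≤ M) (n : ℕ) :
    ‖a ^ n - b ^ n‖ ≤ n * M ^ (n - 1) * ‖a - b‖ := by
  have hM : 0 ≤ M := (norm_nonneg _).trans ha
  rw [← Commute.geom_sum₂_mul (Commute.all a b) n, norm_mul]
  gcongr
  refine (norm_sum_le _ _).trans ?_
  have : ∀ i ∈ Finset.range n, ‖a ^ i * b ^ (n - 1 - i)‖ ≤ M ^ (n - 1) := by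
    intro i hi
    rw [Finset.mem_range] at hi
    rw [norm_mul, norm_pow, norm_pow]
    calc ‖a‖ ^ i * ‖b‖ ^ (n - 1 - i) ≤ M ^ i * M ^ (n - 1 - i) := by gcongr
      _ = M ^ (n - 1) := by rw [← pow_add]; congr 1; omega
  refine (Finset.sum_le_sum this).trans ?_
  simp

/-- Two groups of i.i.d. summands with weights of modulus `1` and `r`: the product of the
characteristic functions is close to the Gaussian one near the origin. -/
lemma norm_mul_pow_sub_gaussian_le {φ : ℝ → ℂ} {s c A : ℝ} (hs : 0 < s) (hA : 0 ≤ A)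
    (hφ : ∀ t, |t| ≤ c → ‖φ t - (Real.exp (-(s * t ^ 2 / 2)) : ℝ)‖ ≤ A * |t| ^ 3 ∧
      ‖φ t‖ ≤ Real.exp (-(s * t ^ 2 / 4)))
    {N k : ℕ} (hk : 1 ≤ k) {r a b : ℝ} (hr0 : 0 ≤ r) (hr1 : r ≤ 1) (hNr : N * r = k)
    (ha : |a| = r) (hb : |b| = 1) {t : ℝ} (ht : |t| ≤ c) :
    ‖φ (a * t) ^ N * φ (b * t) ^ k - (Real.exp (-(s * (k + N * r ^ 2) * t ^ 2 / 2)) : ℝ)‖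
      ≤ A * (Real.exp (s * c ^ 2 / 4) + 1) * k * |t| ^ 3 * Real.exp (-(s * k * t ^ 2 / 4)) := by
  have ht0 := abs_nonneg t
  have ha2 : a ^ 2 = r ^ 2 := by rw [← sq_abs, ha]
  have hb2 : b ^ 2 = 1 := by rw [← sq_abs, hb, one_pow]
  have hat : |a * t| ≤ c := by rw [abs_mul, ha]; nlinarith
  have hbt : |b * t| ≤ c := by rw [abs_mul, hb, one_mul]; exact ht
  obtain ⟨ha3, ha4⟩ := hφ _ hat
  obtain ⟨hb3, hb4⟩ := hφ _ hbt
  rw [abs_mul, ha] at ha3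
  rw [abs_mul, hb, one_mul] at hb3
  rw [mul_pow, ha2] at ha3 ha4
  rw [mul_pow, hb2, one_mul] at hb3 hb4
  set ga : ℂ := ((Real.exp (-(s * (r ^ 2 * t ^ 2) / 2)) : ℝ) : ℂ) with hga
  set gb : ℂ := ((Real.exp (-(s * t ^ 2 / 2)) : ℝ) : ℂ) with hgb
  have hna : ‖φ (a * t)‖ ≤ 1 := ha4.trans (Real.exp_le_one_iff.2 (by
    have : 0 ≤ s * (r ^ 2 * t ^ 2) := by positivity
    linarith))
  have hnga : ‖ga‖ ≤ 1 := by
    rw [hga, Complex.norm_real, Real.norm_eq_abs, Real.abs_exp]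
    refine Real.exp_le_one_iff.2 ?_
    have : 0 ≤ s * (r ^ 2 * t ^ 2) := by positivity
    linarith
  have hst : 0 ≤ s * t ^ 2 := by positivity
  have hngb : ‖gb‖ ≤ Real.exp (-(s * t ^ 2 / 4)) := by
    rw [hgb, Complex.norm_real, Real.norm_eq_abs, Real.abs_exp]
    exact Real.exp_le_exp.2 (by linarith)
  have hprod : ((Real.exp (-(s * (k + N * r ^ 2) * t ^ 2 / 2)) : ℝ) : ℂ) = ga ^ N * gb ^ k := by
    rw [hga, hgb, ← Complex.ofReal_pow, ← Complex.ofReal_pow, ← Complex.ofReal_mul,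
      ← Real.exp_nat_mul, ← Real.exp_nat_mul, ← Real.exp_add]
    congr 2
    ring
  -- All the Gaussian decay is taken from the `k` factors of weight one; the `N` small-weight
  -- factors are only bounded by `1`.
  have hsplit : φ (a * t) ^ N * φ (b * t) ^ k - ga ^ N * gb ^ k
      = φ (a * t) ^ N * (φ (b * t) ^ k - gb ^ k) + (φ (a * t) ^ N - ga ^ N) * gb ^ k := by ring
  have hc2 : t ^ 2 ≤ c ^ 2 := by rw [← sq_abs]; gcongr
  have h1 : ‖φ (b * t) ^ k - gb ^ k‖
      ≤ k * (Real.exp (s * c ^ 2 / 4) * Real.exp (-(s * k * t ^ 2 / 4))) * (A * |t| ^ 3) := by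
    refine (norm_pow_sub_pow_le hb4 hngb k).trans ?_
    -- Telescoping leaves the power `k - 1`; the missing factor costs at most `exp (s c² / 4)`.
    have : Real.exp (-(s * t ^ 2 / 4)) ^ (k - 1)
        ≤ Real.exp (s * c ^ 2 / 4) * Real.exp (-(s * k * t ^ 2 / 4)) := by
      rw [← Real.exp_nat_mul, ← Real.exp_add, Nat.cast_sub hk]
      refine Real.exp_le_exp.2 ?_
      have : s * t ^ 2 ≤ s * c ^ 2 := by gcongr
      push_cast
      linarith
    gcongr
  have h2 : ‖φ (a * t) ^ N - ga ^ N‖ ≤ k * (A * |t| ^ 3) := by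
    refine (norm_pow_sub_pow_le hna hnga N).trans ?_
    rw [one_pow, mul_one]
    -- Many small weights cost no more than the `k` large ones, since `N r³ = k r² ≤ k`.
    calc (N : ℝ) * ‖φ (a * t) - ga‖ ≤ N * (A * (r * |t|) ^ 3) := by gcongr
      _ = (N * r) * r ^ 2 * (A * |t| ^ 3) := by ring
      _ ≤ (N * r) * 1 * (A * |t| ^ 3) := by gcongr; nlinarith
      _ = _ := by rw [hNr, mul_one]
  have h3 : ‖gb ^ k‖ ≤ Real.exp (-(s * k * t ^ 2 / 4)) := by
    rw [norm_pow]
    refine (pow_le_pow_left₀ (norm_nonneg _) hngb k).trans (le_of_eq ?_)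
    rw [← Real.exp_nat_mul]
    congr 1
    ring
  rw [hprod, hsplit]
  calc _ ≤ ‖φ (a * t)‖ ^ N * ‖φ (b * t) ^ k - gb ^ k‖ + ‖φ (a * t) ^ N - ga ^ N‖ * ‖gb ^ k‖ := by
        refine (norm_add_le _ _).trans ?_
        rw [norm_mul, norm_mul, norm_pow]
    _ ≤ 1 * (k * (Real.exp (s * c ^ 2 / 4) * Real.exp (-(s * k * t ^ 2 / 4))) * (A * |t| ^ 3))
        + k * (A * |t| ^ 3) * Real.exp (-(s * k * t ^ 2 / 4)) := by
        gcongr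
        exact pow_le_one₀ (norm_nonneg _) hna
    _ = _ := by ring

lemma cdf_gaussianReal_eq_integral {v : NNReal} (hv : v ≠ 0) (x : ℝ) :
    cdf (gaussianReal 0 v) x = ∫ y in Set.Iic x, gaussianPDFReal 0 v y := by
  rw [cdf_eq_real, measureReal_def, gaussianReal_apply_eq_integral _ hv, ENNReal.toReal_ofReal]
  exact integral_nonneg fun y => gaussianPDFReal_nonneg _ _ _

lemma cdf_gaussianReal_sub {v : NNReal} (hv : v ≠ 0) (a b : ℝ) :
    cdf (gaussianReal 0 v) b - cdf (gaussianReal 0 v) a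
      = ∫ y in a..b, gaussianPDFReal 0 v y := by
  rw [cdf_gaussianReal_eq_integral hv, cdf_gaussianReal_eq_integral hv]
  exact intervalIntegral.integral_Iic_sub_Iic (integrable_gaussianPDFReal _ _).integrableOn
    (integrable_gaussianPDFReal _ _).integrableOn

lemma cdf_gaussianReal_sub_le {v : NNReal} (hv : v ≠ 0) {a b : ℝ} (hab : a ≤ b) :
    cdf (gaussianReal 0 v) b - cdf (gaussianReal 0 v) a ≤ (√(2 * Real.pi * v))⁻¹ * (b - a) := by
  rw [cdf_gaussianReal_sub hv]
  have : ∫ y in a..b, gaussianPDFReal 0 v y ≤ ∫ y in a..b, (√(2 * Real.pi * v))⁻¹ := by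
    refine intervalIntegral.integral_mono_on hab (integrable_gaussianPDFReal _ _).intervalIntegrable
      (by simp) fun y _ => ?_
    rw [gaussianPDFReal]
    refine mul_le_of_le_one_right (by positivity) (Real.exp_le_one_iff.2 ?_)
    have : 0 ≤ (y - 0) ^ 2 / (2 * (v : ℝ)) := by positivity
    rw [neg_div]
    linarith
  refine this.trans (le_of_eq ?_)
  rw [intervalIntegral.integral_const, smul_eq_mul, mul_comm]

lemma cdf_map_const_mul {Ω : Type*} [MeasurableSpace Ω] {P : Measure Ω} [IsProbabilityMeasure P]
    {X : Ω → ℝ} (hX : AEMeasurable X P) {c : ℝ} (hc : 0 < c) (y : ℝ) :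
    cdf (P.map fun ω => c * X ω) (c * y) = cdf (P.map X) y := by
  have hcX : AEMeasurable (fun ω => c * X ω) P := hX.const_mul c
  have := Measure.isProbabilityMeasure_map hX
  have := Measure.isProbabilityMeasure_map hcX
  rw [cdf_eq_real, cdf_eq_real, map_measureReal_apply_of_aemeasurable hX measurableSet_Iic,
    map_measureReal_apply_of_aemeasurable hcX measurableSet_Iic]
  congr 1
  ext ω
  simp [hc]

lemma cdf_gaussianReal_sq {v : NNReal} {c : ℝ} (hc : 0 < c) (hv : (v : ℝ) = c ^ 2) (y : ℝ) :
    cdf (gaussianReal 0 v) (c * y) = cdf (gaussianReal 0 1) y := by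
  have h := cdf_map_const_mul (P := gaussianReal 0 1) (X := id) aemeasurable_id hc y
  simp only [id, Measure.map_id] at h
  rw [gaussianReal_map_const_mul] at h
  convert! h using 3
  rw [mul_zero, mul_one]
  congr 1
  exact NNReal.eq hv

/-- A **Berry–Esseen bound** for a weighted sum of `k` i.i.d. terms with weight of modulus one and
`N` further terms with smaller weights of modulus `r`, where `N * r = k`. -/
theorem exists_berry_esseen_two_groups {μ : Measure ℝ} [IsProbabilityMeasure μ]
    (h3 : Integrable (fun y : ℝ => |y| ^ 3) μ) (hmean : ∫ y, y ∂μ = 0) {s : ℝ}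
    (hs : s = ∫ y, y ^ 2 ∂μ) (hs0 : 0 < s) :
    ∃ C : ℝ, 0 ≤ C ∧ ∀ (k N : ℕ) (r a b : ℝ) (v : NNReal) (ν : Measure ℝ)
      [IsProbabilityMeasure ν], Integrable id ν → 1 ≤ k → 0 ≤ r → r ≤ 1 → N * r = k →
      |a| = r → |b| = 1 → (v : ℝ) = s * (k + N * r ^ 2) →
      (∀ t, charFun ν t = charFun μ (a * t) ^ N * charFun μ (b * t) ^ k) →
      ∀ x, |cdf ν x - cdf (gaussianReal 0 v) x| ≤ C / √k := by
  obtain ⟨c, A, hc, hA, hφ⟩ := exists_charFun_bounds h3 hmean hs hs0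
  let D : ℝ := A * (Real.exp (s * c ^ 2 / 4) + 1)
  have hD : 0 ≤ D := by positivity
  refine ⟨5 * (D * (8 / s) * √(Real.pi / (s / 8))) + 1040 * ((√s)⁻¹ / c), by positivity, ?_⟩
  intro k N r a b v ν _ hν hk hr0 hr1 hNr ha hb hv hchar x
  have hk0 : (0 : ℝ) < k := by exact_mod_cast hk
  have hsk : s * k ≤ v := by
    rw [hv]
    have : 0 ≤ N * r ^ 2 := by positivity
    nlinarith
  have hv0 : (0 : ℝ) < v := lt_of_lt_of_le (by positivity) hsk
  have hvne : v ≠ 0 := by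
    rintro rfl
    simp at hv0
  -- Half of the exponent absorbs the factor `k t²`, leaving a Gaussian whose integral is of order
  -- `1 / √k`. The sum is not normalised, so the cutoff `T = c` is fixed, and the Lipschitz constant
  -- `m = 1 / √(s k)` supplies the same order.
  let B : ℝ → ℝ := fun t => D * (8 / s) * Real.exp (-(s * k / 8) * t ^ 2)
  have hBint : Integrable B := (integrable_exp_neg_mul_sq (by positivity)).const_mul _
  have hm : 0 < (√(s * k))⁻¹ := by positivity
  have key := abs_cdf_sub_cdf_le (μ := ν) (ν := gaussianReal 0 v) (m := (√(s * k))⁻¹) (T := c)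
    (B := B) hν (IsGaussian.integrable_id) hm hc (fun p q hpq => ?_) hBint.intervalIntegrable
    (fun t ht => ?_) x
  · refine key.trans ?_
    have hI : ∫ t in (-c)..c, B t ≤ D * (8 / s) * √(Real.pi / (s / 8)) / √k := by
      rw [intervalIntegral.integral_of_le (by linarith)]
      refine (setIntegral_le_integral hBint (ae_of_all _ fun t => ?_)).trans (le_of_eq ?_)
      · simp only [B, Pi.zero_apply]; positivity
      · simp only [B]
        rw [integral_const_mul, integral_gaussian, mul_div_assoc (D * (8 / s)), ← Real.sqrt_div' _ hk0.le]
        congr 2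
        rw [div_div]
        congr 1
        ring
    have hm' : (√(s * k))⁻¹ = (√s)⁻¹ / √k := by
      rw [Real.sqrt_mul hs0.le, mul_inv, div_eq_mul_inv]
    rw [hm']
    calc _ ≤ 5 * (D * (8 / s) * √(Real.pi / (s / 8)) / √k) + 1040 * ((√s)⁻¹ / √k / c) := by gcongr
      _ = _ := by ring
  · refine (cdf_gaussianReal_sub_le hvne hpq).trans ?_
    have : 1 * (v : ℝ) ≤ 2 * Real.pi * v := by
      gcongr
      linarith [Real.pi_gt_three]
    exact mul_le_mul_of_nonneg_right
      (inv_anti₀ (by positivity) (Real.sqrt_le_sqrt (by linarith))) (by linarith)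
  · have h1 := norm_mul_pow_sub_gaussian_le hs0 hA hφ hk hr0 hr1 hNr ha hb ht
    have h2 : charFun (gaussianReal 0 v) t
        = (Real.exp (-(s * (k + N * r ^ 2) * t ^ 2 / 2)) : ℝ) := by
      rw [charFun_gaussianReal, ← hv, Complex.ofReal_exp]
      congr 1
      push_cast
      ring
    rw [hchar, h2]
    refine h1.trans ?_
    have h4 : s * k * t ^ 2 / 8 * Real.exp (-(s * k * t ^ 2 / 4))
        ≤ Real.exp (-(s * k / 8) * t ^ 2) := by
      have : Real.exp (-(s * k / 8) * t ^ 2)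
          = Real.exp (s * k * t ^ 2 / 8) * Real.exp (-(s * k * t ^ 2 / 4)) := by
        rw [← Real.exp_add]; congr 1; ring
      rw [this]
      gcongr
      linarith [Real.add_one_le_exp (s * k * t ^ 2 / 8)]
    calc _ = |t| * (D * (8 / s) * (s * k * t ^ 2 / 8 * Real.exp (-(s * k * t ^ 2 / 4)))) := by
          rw [← sq_abs t]; simp only [D]; field_simp
      _ ≤ |t| * B t := by simp only [B]; gcongr

/-! ### The normal distribution function under a change of scale. -/

/-- The constant is `1 + 128`, from `|x|³ ≤ 1 + x⁴` and `x⁴ / 128 ≤ exp (x² / 8)`. -/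
lemma abs_cube_mul_exp_le (x : ℝ) : |x| ^ 3 * Real.exp (-(x ^ 2 / 8)) ≤ 129 := by
  have h1 := Real.quadratic_le_exp_of_nonneg (x := x ^ 2 / 8) (by positivity)
  rw [Real.exp_neg, ← div_eq_mul_inv, div_le_iff₀ (Real.exp_pos _)]
  have h2 : |x| ^ 3 ≤ 1 + |x| ^ 4 := by
    rcases le_total |x| 1 with h | h
    · have := pow_le_one₀ (n := 3) (abs_nonneg x) h
      have : 0 ≤ |x| ^ 4 := by positivity
      linarith
    · have := pow_le_pow_right₀ h (show 3 ≤ 4 by norm_num)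
      linarith
  have h3 : |x| ^ 4 = x ^ 4 := by rw [← abs_pow]; exact abs_of_nonneg (by positivity)
  nlinarith [sq_nonneg x]

/-- Mean value inequality in the scale `u`: for `u` in `[1/2, 2]` the derivative is at most `2 |x|³
exp (-x² / 8)` in absolute value, uniformly bounded in `x`. -/
lemma abs_mul_exp_sub_mul_exp_le (x : ℝ) {u : ℝ} (hu1 : 1 / 2 ≤ u) (hu2 : u ≤ 2) :
    |x * Real.exp (-(x * u) ^ 2 / 2) - x * Real.exp (-x ^ 2 / 2)| ≤ 258 * |u - 1| := by
  have hd (w : ℝ) : HasDerivAt (fun u : ℝ => x * Real.exp (-(x * u) ^ 2 / 2))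
      (x * (Real.exp (-(x * w) ^ 2 / 2) * (-(x ^ 2 * w)))) w := by
    have h1 : HasDerivAt (fun u : ℝ => -(x * u) ^ 2 / 2) (-(x ^ 2 * w)) w := by
      have := (((hasDerivAt_id w).const_mul x).pow 2).neg.div_const 2
      convert! this using 1
      simp
      ring
    exact h1.exp.const_mul x
  have := (convex_Icc (1 / 2 : ℝ) 2).norm_image_sub_le_of_norm_hasDerivWithin_le
    (C := 258) (fun w _ => (hd w).hasDerivWithinAt) (fun w hw => ?_)
    (show (1 : ℝ) ∈ Set.Icc (1 / 2 : ℝ) 2 by norm_num) (show u ∈ _ from ⟨hu1, hu2⟩)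
  · simpa using this
  · have he : Real.exp (-(x * w) ^ 2 / 2) ≤ Real.exp (-(x ^ 2 / 8)) := by
      refine Real.exp_le_exp.2 ?_
      have : 1 / 4 ≤ w ^ 2 := by nlinarith [hw.1]
      nlinarith [sq_nonneg x]
    have hw0 : 0 ≤ w := by linarith [hw.1]
    rw [norm_mul, norm_mul, norm_neg, norm_mul, norm_pow, Real.norm_eq_abs, Real.norm_eq_abs,
      Real.norm_eq_abs, Real.abs_exp, abs_of_nonneg hw0]
    calc |x| * (Real.exp (-(x * w) ^ 2 / 2) * (|x| ^ 2 * w))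
        ≤ |x| * (Real.exp (-(x ^ 2 / 8)) * (|x| ^ 2 * 2)) := by gcongr; exact hw.2
      _ = 2 * (|x| ^ 3 * Real.exp (-(x ^ 2 / 8))) := by ring
      _ ≤ 258 := by linarith [abs_cube_mul_exp_le x]

lemma abs_mul_exp_neg_sq_le (x : ℝ) : |x * Real.exp (-x ^ 2 / 2)| ≤ 1 := by
  rw [abs_mul, Real.abs_exp, neg_div, Real.exp_neg, ← div_eq_mul_inv, div_le_one (Real.exp_pos _)]
  have h1 := Real.add_one_le_exp (x ^ 2 / 2)
  nlinarith [sq_nonneg (|x| - 1), sq_abs x]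

/-- The substitution `y = x u` frees the limits of integration from `x`, which makes estimates
uniform in `x` possible. -/
lemma cdf_stdGaussian_mul_sub (x p q : ℝ) :
    cdf (gaussianReal 0 1) (p * x) - cdf (gaussianReal 0 1) (q * x)
      = (√(2 * Real.pi))⁻¹ * ∫ u in q..p, x * Real.exp (-(x * u) ^ 2 / 2) := by
  rw [cdf_gaussianReal_sub one_ne_zero, intervalIntegral.integral_const_mul,
    ← mul_comm x p, ← mul_comm x q,
    ← intervalIntegral.mul_integral_comp_mul_left (f := gaussianPDFReal 0 1)]
  simp only [gaussianPDFReal, NNReal.coe_one, mul_one, sub_zero]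
  rw [intervalIntegral.integral_const_mul]
  ring

/-- Second-order expansion of the standard normal distribution function under a change of
scale, uniform in the argument. -/
lemma abs_cdf_stdGaussian_scale_sub_le (x : ℝ) {h : ℝ} (h0 : 0 ≤ h) (h1 : h ≤ 1 / 2) :
    |cdf (gaussianReal 0 1) (√(1 + h) * x) - cdf (gaussianReal 0 1) (√(1 - h) * x)
      - x * Real.exp (-x ^ 2 / 2) / √(2 * Real.pi) * h| ≤ 1000 * h ^ 2 := by
  set p := √(1 + h) with hp
  set q := √(1 - h) with hq
  have hp2 : p ^ 2 = 1 + h := Real.sq_sqrt (by linarith)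
  have hq2 : q ^ 2 = 1 - h := Real.sq_sqrt (by linarith)
  have hp0 : 0 ≤ p := Real.sqrt_nonneg _
  have hq0 : 0 ≤ q := Real.sqrt_nonneg _
  have hp1 : 1 ≤ p := by nlinarith
  have hq1 : q ≤ 1 := by nlinarith
  have hq3 : 1 - h ≤ q := by nlinarith
  have hp3 : p ≤ 1 + h := by nlinarith
  -- The linear terms of `√(1 ± h) = 1 ± h / 2 + O(h²)` add up to `h`.
  have hpq : |p - q - h| ≤ 2 * h ^ 2 := by
    have e1 : p ≤ 1 + h / 2 := by nlinarith
    have e2 : 1 + h / 2 - h ^ 2 ≤ p := by nlinarith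
    have e3 : q ≤ 1 - h / 2 := by nlinarith
    have e4 : 1 - h / 2 - h ^ 2 ≤ q := by
      refine le_of_sq_le_sq ?_ hq0
      rw [hq2]
      nlinarith [mul_nonneg h0 (sq_nonneg h), mul_nonneg h0 h0]
    rw [abs_le]
    constructor <;> linarith [sq_nonneg h]
  set w := x * Real.exp (-x ^ 2 / 2) with hw
  have hc : Continuous fun u : ℝ => x * Real.exp (-(x * u) ^ 2 / 2) := by fun_prop
  -- The integrand is frozen at `u = 1`: the error is at most `258 h` on an interval of length at
  -- most `2h`.
  have hI : |(∫ u in q..p, x * Real.exp (-(x * u) ^ 2 / 2)) - (p - q) * w| ≤ 516 * h ^ 2 := by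
    have : (∫ u in q..p, x * Real.exp (-(x * u) ^ 2 / 2)) - (p - q) * w
        = ∫ u in q..p, (x * Real.exp (-(x * u) ^ 2 / 2) - w) := by
      rw [intervalIntegral.integral_sub (hc.intervalIntegrable _ _) (by simp),
        intervalIntegral.integral_const, smul_eq_mul]
    rw [this, ← Real.norm_eq_abs]
    refine (intervalIntegral.norm_integral_le_of_norm_le_const (C := 258 * h) fun u hu => ?_).trans ?_
    · rw [Set.uIoc_of_le (hq1.trans hp1)] at hu
      refine (abs_mul_exp_sub_mul_exp_le x (by linarith [hu.1]) (by linarith [hu.2])).trans ?_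
      gcongr
      rw [abs_le]
      constructor <;> linarith [hu.1, hu.2]
    · rw [abs_of_nonneg (by linarith)]
      nlinarith
  have hs : (√(2 * Real.pi))⁻¹ ≤ 1 := by
    refine inv_le_one_of_one_le₀ (Real.one_le_sqrt.2 ?_)
    linarith [Real.pi_gt_three]
  have hs0 : 0 ≤ (√(2 * Real.pi))⁻¹ := by positivity
  have hw1 : |w| ≤ 1 := abs_mul_exp_neg_sq_le x
  rw [cdf_stdGaussian_mul_sub, show ∀ I : ℝ, (√(2 * Real.pi))⁻¹ * I - w / √(2 * Real.pi) * h
    = (√(2 * Real.pi))⁻¹ * ((I - (p - q) * w) + (p - q - h) * w) by intro I; ring, abs_mul,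
    abs_of_nonneg hs0]
  refine (mul_le_of_le_one_left (abs_nonneg _) hs).trans ((abs_add_le _ _).trans ?_)
  have : |(p - q - h) * w| ≤ 2 * h ^ 2 := by
    rw [abs_mul]
    exact (mul_le_of_le_one_right (abs_nonneg _) hw1).trans hpq
  nlinarith [sq_nonneg h]

/-! ### Sample-mean increments as weighted sums. -/

section WeightedSum

variable {Ω : Type*} {Y : ℕ → Ω → ℝ}

/-- The sum with weight `a` on the first `N` terms and weight `b` on the next `k` terms. -/
def twoWeightSum (Y : ℕ → Ω → ℝ) (N k : ℕ) (a b : ℝ) (ω : Ω) : ℝ :=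
  a * ∑ i ∈ Finset.range N, Y i ω + b * ∑ i ∈ Finset.range k, Y (N + i) ω

lemma twoWeightSum_eq_sum (N k : ℕ) (a b : ℝ) :
    twoWeightSum Y N k a b
      = fun ω => ∑ i ∈ Finset.range (N + k), (if i < N then a else b) * Y i ω := by
  ext ω
  rw [Finset.sum_range_add, twoWeightSum, Finset.mul_sum, Finset.mul_sum]
  congr 1
  · exact Finset.sum_congr rfl fun i hi => by rw [if_pos (Finset.mem_range.1 hi)]
  · exact Finset.sum_congr rfl fun i _ => by rw [if_neg (by omega)]

variable [MeasurableSpace Ω] {P : Measure Ω}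

lemma aemeasurable_twoWeightSum (hY : ∀ i, AEMeasurable (Y i) P) (N k : ℕ) (a b : ℝ) :
    AEMeasurable (twoWeightSum Y N k a b) P := by
  rw [twoWeightSum_eq_sum]
  exact Finset.aemeasurable_fun_sum _ fun i _ => (hY i).const_mul _

lemma integrable_twoWeightSum (hY : ∀ i, Integrable (Y i) P) (N k : ℕ) (a b : ℝ) :
    Integrable (twoWeightSum Y N k a b) P := by
  rw [twoWeightSum_eq_sum]
  exact integrable_finsetSum _ fun i _ => (hY i).const_mul _

lemma charFun_map_twoWeightSum [IsProbabilityMeasure P] (hindep : iIndepFun Y P)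
    (hident : ∀ i, IdentDistrib (Y i) (Y 0) P P) (N k : ℕ) (a b t : ℝ) :
    charFun (P.map (twoWeightSum Y N k a b)) t
      = charFun (P.map (Y 0)) (a * t) ^ N * charFun (P.map (Y 0)) (b * t) ^ k := by
  have hY i : AEMeasurable (Y i) P := (hident i).aemeasurable_fst
  have hind : iIndepFun (fun i ω => (if i < N then a else b) * Y i ω) P :=
    hindep.comp (fun i x => (if i < N then a else b) * x) fun i => by fun_prop
  rw [twoWeightSum_eq_sum, (hind.restrict _).charFun_map_fun_finsetSum_eq_prod
    fun i _ => (hY i).const_mul _, Finset.prod_apply]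
  have h1 (i : ℕ) : charFun (P.map fun ω => (if i < N then a else b) * Y i ω) t
      = charFun (P.map (Y 0)) ((if i < N then a else b) * t) := by
    rw [charFun_map_mul_comp (hY i), (hident i).map_eq]
  simp_rw [h1]
  rw [Finset.prod_range_add]
  congr 1
  · rw [Finset.prod_congr rfl fun i hi => by rw [if_pos (Finset.mem_range.1 hi)]]
    simp
  · simp

end WeightedSum

section SampleMean

variable {Ω : Type*} {X : ℕ → Ω → ℝ}

/-- The weights `-k / n` on `n` terms and `1` on `k` terms sum to zero, so any centring `m` is free.
The same holds in `mul_deltaMinus_eq`. -/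
lemma mul_deltaPlus_eq {n k : ℕ} (hn : 1 ≤ n) (m : ℝ) (ω : Ω) :
    ((n + k : ℕ) : ℝ) * deltaPlus X n k ω
      = twoWeightSum (fun i ω => X i ω - m) n k (-(k / n)) 1 ω := by
  have h1 : (n : ℝ) ≠ 0 := by positivity
  have h2 : ((n + k : ℕ) : ℝ) ≠ 0 := by positivity
  simp only [deltaPlus, sampleMean, twoWeightSum, Finset.sum_sub_distrib, Finset.sum_const,
    Finset.card_range, nsmul_eq_mul, Finset.sum_range_add]
  field_simp
  push_cast
  ring

lemma mul_deltaMinus_eq {N k : ℕ} (hN : 1 ≤ N) (m : ℝ) (ω : Ω) :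
    ((N + k : ℕ) : ℝ) * deltaMinus X (N + k) k ω
      = twoWeightSum (fun i ω => X i ω - m) N k (k / N) (-1) ω := by
  have h1 : (N : ℝ) ≠ 0 := by positivity
  have h2 : ((N + k : ℕ) : ℝ) ≠ 0 := by positivity
  simp only [deltaMinus, sampleMean, twoWeightSum, Finset.sum_sub_distrib, Finset.sum_const,
    Finset.card_range, nsmul_eq_mul, Finset.sum_range_add, Nat.add_sub_cancel]
  field_simp
  push_cast
  ring

end SampleMean

/-! ### Normal approximation of the two distribution functions. -/

section Approximation

variable {Ω : Type*} [MeasurableSpace Ω] {P : Measure Ω} [IsProbabilityMeasure P]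

lemma integrable_abs_sub_pow_three {X : Ω → ℝ} (hX : AEMeasurable X P)
    (h : Integrable (fun ω => |X ω| ^ 3) P) (m : ℝ) :
    Integrable (fun ω => |X ω - m| ^ 3) P := by
  refine ((h.add (integrable_const (|m| ^ 3))).const_mul 4).mono'
    (by fun_prop) (ae_of_all _ fun ω => ?_)
  rw [Real.norm_eq_abs, abs_of_nonneg (by positivity), Pi.add_apply]
  have h1 : |X ω - m| ≤ |X ω| + |m| := abs_sub _ _
  refine (pow_le_pow_left₀ (abs_nonneg _) h1 3).trans ?_
  nlinarith [mul_nonneg (add_nonneg (abs_nonneg (X ω)) (abs_nonneg m)) (sq_nonneg (|X ω| - |m|))]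

lemma memLp_two_of_abs_pow_three {X : Ω → ℝ} (hX : AEMeasurable X P)
    (h : Integrable (fun ω => |X ω| ^ 3) P) : MemLp X 2 P := by
  rw [memLp_two_iff_integrable_sq hX.aestronglyMeasurable]
  refine ((integrable_const (1 : ℝ)).add h).mono' (by fun_prop) (ae_of_all _ fun ω => ?_)
  simp only [Real.norm_eq_abs, Pi.add_apply, abs_pow]
  nlinarith [sq_nonneg (|X ω| - 1), abs_nonneg (X ω),
    mul_nonneg (abs_nonneg (X ω)) (sq_nonneg (|X ω| - 1))]

lemma variance_pos_of_not_isLatticeRV {X : Ω → ℝ} (hX : MemLp X 2 P) (h : ¬ IsLatticeRV X P) :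
    0 < variance X P := by
  refine lt_of_le_of_ne (variance_nonneg _ _) fun h0 => h ⟨∫ ω, X ω ∂P, 1, one_pos, ?_⟩
  filter_upwards [ae_eq_integral_of_variance_eq_zero hX h0.symm] with ω hω
  exact ⟨0, by simpa using hω⟩

/-- Normal approximation of the law of a weighted sum of i.i.d. centered variables, after
multiplication of the variable by a constant. -/
lemma exists_normal_approx_twoWeightSum {X : ℕ → Ω → ℝ} (hindep : iIndepFun X P)
    (hident : ∀ i, IdentDistrib (X i) (X 0) P P)
    (hmom : Integrable (fun ω => |X 0 ω| ^ 3) P) (hvar : 0 < variance (X 0) P) :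
    ∃ C : ℝ, 0 ≤ C ∧ ∀ (k N : ℕ) (r a b c : ℝ), 1 ≤ k → 0 ≤ r → r ≤ 1 → N * r = k → |a| = r →
      |b| = 1 → 0 < c → c ^ 2 = variance (X 0) P * (k + N * r ^ 2) → ∀ x,
        |cdf (P.map (twoWeightSum (fun i ω => X i ω - ∫ ω, X 0 ω ∂P) N k a b)) (c * x)
          - cdf (gaussianReal 0 1) x| ≤ C / √k := by
  set m := ∫ ω, X 0 ω ∂P with hm
  let Y : ℕ → Ω → ℝ := fun i ω => X i ω - m
  have hX i : AEMeasurable (X i) P := (hident i).aemeasurable_fst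
  have hYind : iIndepFun Y P := hindep.comp (fun _ x => x - m) fun _ => by fun_prop
  have hYid i : IdentDistrib (Y i) (Y 0) P P := (hident i).comp (u := fun x => x - m) (by fun_prop)
  have hY i : AEMeasurable (Y i) P := (hYid i).aemeasurable_fst
  have hX1 : Integrable (X 0) P := (memLp_two_of_abs_pow_three (hX 0) hmom).integrable one_le_two
  have hYint i : Integrable (Y i) P :=
    (hYid i).integrable_iff.2 (hX1.sub (integrable_const m))
  have hprob : IsProbabilityMeasure (P.map (Y 0)) := Measure.isProbabilityMeasure_map (hY 0)
  have h3 : Integrable (fun y : ℝ => |y| ^ 3) (P.map (Y 0)) :=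
    (integrable_map_measure (by fun_prop) (hY 0)).2 (integrable_abs_sub_pow_three (hX 0) hmom m)
  have hmean : ∫ y, y ∂(P.map (Y 0)) = 0 := by
    rw [integral_map (hY 0) (by fun_prop), integral_sub hX1 (integrable_const m)]
    simp [hm]
  have hs : variance (X 0) P = ∫ y, y ^ 2 ∂(P.map (Y 0)) := by
    rw [integral_map (hY 0) (by fun_prop), variance_eq_integral (hX 0)]
  obtain ⟨C, hC, hBE⟩ := exists_berry_esseen_two_groups h3 hmean hs hvar
  refine ⟨C, hC, fun k N r a b c hk hr0 hr1 hNr ha hb hc hc2 x => ?_⟩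
  have hZ := aemeasurable_twoWeightSum hY N k a b
  have := Measure.isProbabilityMeasure_map hZ
  have hZi : Integrable id (P.map (twoWeightSum Y N k a b)) :=
    (integrable_map_measure (by fun_prop) hZ).2 (integrable_twoWeightSum hYint N k a b)
  obtain ⟨v, hv⟩ : ∃ v : NNReal, (v : ℝ) = c ^ 2 := ⟨⟨c ^ 2, sq_nonneg c⟩, rfl⟩
  have key := hBE k N r a b v (P.map (twoWeightSum Y N k a b)) hZi hk hr0 hr1
    hNr ha hb (hv.trans hc2) (charFun_map_twoWeightSum hYind hYid N k a b) (c * x)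
  rwa [cdf_gaussianReal_sq hc hv] at key

lemma exists_normal_approx_FPlus_FMinus {X : ℕ → Ω → ℝ} (hindep : iIndepFun X P)
    (hident : ∀ i, IdentDistrib (X i) (X 0) P P)
    (hmom : Integrable (fun ω => |X 0 ω| ^ 3) P) {σ : ℝ} (hσ : 0 < σ)
    (hσ2 : σ ^ 2 = variance (X 0) P) :
    ∃ C : ℝ, 0 ≤ C ∧ ∀ n k : ℕ, 1 ≤ k → 2 * k ≤ n → ∀ x : ℝ,
      |FPlus P X n k (√k * σ * x / n) - cdf (gaussianReal 0 1) (√(1 + k / n) * x)| ≤ C / √k ∧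
      |FMinus P X n k (√k * σ * x / n) - cdf (gaussianReal 0 1) (√(1 - k / n) * x)| ≤ C / √k := by
  obtain ⟨C, hC, h⟩ := exists_normal_approx_twoWeightSum hindep hident hmom (by rw [← hσ2]; positivity)
  refine ⟨C, hC, fun n k hk hkn x => ?_⟩
  have hX i : AEMeasurable (X i) P := (hident i).aemeasurable_fst
  have hmean n : AEMeasurable (sampleMean X n) P :=
    (Finset.aemeasurable_fun_sum _ fun i _ => hX i).const_mul _
  have hk0 : (0 : ℝ) < k := by exact_mod_cast hk
  have hsk : √(k : ℝ) ^ 2 = k := Real.sq_sqrt hk0.le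
  have hsk0 : 0 < √(k : ℝ) := by positivity
  -- The retained size `N` is at least `k` because `2 * k ≤ n`, so the weight `k / N` does not
  -- exceed one.
  obtain ⟨N, rfl⟩ : ∃ N, n = N + k := ⟨n - k, by omega⟩
  have hkN : k ≤ N := by omega
  have hkN' : (k : ℝ) ≤ N := by exact_mod_cast hkN
  have hN0 : (0 : ℝ) < N := hk0.trans_le hkN'
  have hn0 : (0 : ℝ) < ((N + k : ℕ) : ℝ) := by push_cast; positivity
  constructor
  · set n := N + k
    have hc : √(1 + k / n : ℝ) ^ 2 = 1 + k / n := Real.sq_sqrt (by positivity)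
    -- The scale is the standard deviation of the weighted sum. One factor `√(1 + k / n)` of the
    -- rescaled argument cancels against it and the other stays with `x`.
    have := h k n (k / n) (-(k / n)) 1 (σ * √k * √(1 + k / n)) hk (by positivity)
      (by rw [div_le_one hn0]; simp only [n]; push_cast; linarith) (by field_simp)
      (by rw [abs_neg, abs_of_nonneg (by positivity)]) (by simp) (by positivity)
      (by rw [mul_pow, mul_pow, hc, hsk, hσ2]; field_simp) (√(1 + k / n) * x)
    convert! this using 3
    have hnk0 : (0 : ℝ) < ((n + k : ℕ) : ℝ) := by push_cast; positivity
    have hd : AEMeasurable (deltaPlus X n k) P := (hmean _).sub (hmean _)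
    rw [FPlus, ← cdf_map_const_mul hd hnk0, funext fun ω => mul_deltaPlus_eq (by omega) _ ω]
    congr 1
    calc ((n + k : ℕ) : ℝ) * (√k * σ * x / n) = σ * √k * (1 + k / n) * x := by
            push_cast; field_simp
        _ = σ * √k * (√(1 + k / n) ^ 2) * x := by rw [hc]
        _ = _ := by ring
  · have hfrac : (1 - k / ((N + k : ℕ) : ℝ)) = N / ((N + k : ℕ) : ℝ) := by
      field_simp; push_cast; ring
    rw [hfrac]
    have hprod : √(((N + k : ℕ) : ℝ) / N) * √(N / ((N + k : ℕ) : ℝ)) = 1 := by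
      rw [← Real.sqrt_mul (by positivity), div_mul_div_cancel₀ hN0.ne', div_self hn0.ne',
        Real.sqrt_one]
    have hc : √(((N + k : ℕ) : ℝ) / N) ^ 2 = ((N + k : ℕ) : ℝ) / N := Real.sq_sqrt (by positivity)
    -- Here the rescaled argument is `σ √k x`; division by the standard deviation `σ √k √(n / N)`,
    -- with `n = N + k`, leaves `√(N / n) x = √(1 - k / n) x`.
    have := h k N (k / N) (k / N) (-1) (σ * √k * √(((N + k : ℕ) : ℝ) / N)) hk (by positivity)
      (by rw [div_le_one hN0]; exact hkN') (by field_simp)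
      (by rw [abs_of_nonneg (by positivity)]) (by simp) (by positivity)
      (by rw [mul_pow, mul_pow, hc, hsk, hσ2]; push_cast; field_simp)
      (√(N / ((N + k : ℕ) : ℝ)) * x)
    convert! this using 3
    have hd : AEMeasurable (deltaMinus X (N + k) k) P := (hmean _).sub (hmean _)
    rw [FMinus, ← cdf_map_const_mul hd hn0, funext fun ω => mul_deltaMinus_eq (by omega) _ ω]
    congr 1
    calc ((N + k : ℕ) : ℝ) * (√k * σ * x / ((N + k : ℕ) : ℝ)) = σ * √k * 1 * x := by
            field_simp
        _ = _ := by rw [← hprod]; ring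

end Approximation

/-! ### Growth rates and conclusion. -/

lemma tendsto_div_of_isEquivalent_rpow {α : ℝ} (hα1 : α < 1) {k : ℕ → ℕ}
    (hk : (fun n : ℕ => (k n : ℝ)) ~[atTop] (fun n : ℕ => (n : ℝ) ^ α)) :
    Tendsto (fun n : ℕ => (k n : ℝ) / n) atTop (𝓝 0) := by
  have h1 : Tendsto (fun n : ℕ => (n : ℝ) ^ (-(1 - α))) atTop (𝓝 0) :=
    (tendsto_rpow_neg_atTop (by linarith)).comp tendsto_natCast_atTop_atTop
  have h2 : (fun n : ℕ => (k n : ℝ) / n) ~[atTop] fun n : ℕ => (n : ℝ) ^ (-(1 - α)) := by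
    refine (hk.div (IsEquivalent.refl (u := fun n : ℕ => (n : ℝ)))).congr_right ?_
    filter_upwards [eventually_gt_atTop 0] with n hn
    have hn' : (0 : ℝ) < n := by exact_mod_cast hn
    rw [neg_sub, Real.rpow_sub hn', Real.rpow_one]
    rfl
  exact h2.symm.tendsto_nhds h1

/-- This says `1 / √k = o(k / n)`: the quotient behaves like `n ^ (3α/2 - 1)`, whose exponent is
positive because `α > 2/3`. -/
lemma tendsto_mul_sqrt_div_of_isEquivalent_rpow {α : ℝ} (hα : 2 / 3 < α) {k : ℕ → ℕ}
    (hk : (fun n : ℕ => (k n : ℝ)) ~[atTop] (fun n : ℕ => (n : ℝ) ^ α)) :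
    Tendsto (fun n : ℕ => (k n : ℝ) * √(k n) / n) atTop atTop := by
  have hpos : ∀ᶠ n : ℕ in atTop, (0 : ℝ) < n := by
    filter_upwards [eventually_gt_atTop 0] with n hn
    exact_mod_cast hn
  have hne : ∀ᶠ n : ℕ in atTop, (n : ℝ) ^ α ≠ 0 := by
    filter_upwards [hpos] with n hn
    positivity
  have h1 : Tendsto (fun n : ℕ => (k n : ℝ) / (n : ℝ) ^ α) atTop (𝓝 1) :=
    (isEquivalent_iff_tendsto_one hne).1 hk
  have h2 : Tendsto (fun n : ℕ => (k n : ℝ) / (n : ℝ) ^ α * √((k n : ℝ) / (n : ℝ) ^ α))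
      atTop (𝓝 1) := by simpa using h1.mul h1.sqrt
  have h3 : Tendsto (fun n : ℕ => (n : ℝ) ^ (3 / 2 * α - 1)) atTop atTop :=
    (tendsto_rpow_atTop (by linarith)).comp tendsto_natCast_atTop_atTop
  refine (h2.pos_mul_atTop one_pos h3).congr' ?_
  filter_upwards [hpos] with n hn
  have e1 : √((n : ℝ) ^ α) = (n : ℝ) ^ (α / 2) := by
    rw [Real.sqrt_eq_rpow, ← Real.rpow_mul hn.le]
    congr 1
    ring
  have e2 : (n : ℝ) ^ (3 / 2 * α - 1) = (n : ℝ) ^ α * (n : ℝ) ^ (α / 2) / n := by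
    rw [← Real.rpow_add hn, Real.rpow_sub hn, Real.rpow_one]
    congr 2
    ring
  rw [Real.sqrt_div' _ (by positivity), e1, e2]
  field_simp

theorem theorem2 {Ω : Type*} [MeasurableSpace Ω] (P : Measure Ω) [IsProbabilityMeasure P]
    (X : ℕ → Ω → ℝ)
    (hindep : iIndepFun X P)
    (hident : ∀ i, IdentDistrib (X i) (X 0) P P)
    (hdisc : IsDiscreteRV (X 0) P)
    (hnonlat : ¬ IsLatticeRV (X 0) P)
    (hmom : Integrable (fun ω => |X 0 ω| ^ 3) P)
    (α : ℝ) (hα : α ∈ Set.Ioo (2 / 3 : ℝ) 1)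
    (k : ℕ → ℕ) (hk : (fun n : ℕ => (k n : ℝ)) ~[atTop] (fun n : ℕ => (n : ℝ) ^ α))
    (σ : ℝ) (hσ : σ = Real.sqrt (variance (X 0) P)) :
    ∀ ε : ℝ, 0 < ε → ∀ᶠ n : ℕ in atTop, ∀ x : ℝ,
      |FPlus P X n (k n) (Real.sqrt (k n) * σ * x / n)
          - FMinus P X n (k n) (Real.sqrt (k n) * σ * x / n)
          - x * Real.exp (-x ^ 2 / 2) / Real.sqrt (2 * Real.pi) * ((k n : ℝ) / n)|
        ≤ ε * ((k n : ℝ) / n) := by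
  intro ε hε
  have hX0 : AEMeasurable (X 0) P := (hident 0).aemeasurable_fst
  have hvar := variance_pos_of_not_isLatticeRV (memLp_two_of_abs_pow_three hX0 hmom) hnonlat
  have hσ0 : 0 < σ := by rw [hσ]; positivity
  have hσ2 : σ ^ 2 = variance (X 0) P := by rw [hσ, Real.sq_sqrt hvar.le]
  obtain ⟨C, hC, happ⟩ := exists_normal_approx_FPlus_FMinus hindep hident hmom hσ0 hσ2
  have hlim0 := tendsto_div_of_isEquivalent_rpow hα.2 hk
  have hlim1 := tendsto_mul_sqrt_div_of_isEquivalent_rpow hα.1 hk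
  -- The budget in units of `k / n`: `ε / 2` for the quadratic Gaussian error `1000 (k / n)²`, and
  -- `ε / 4` for each of the two Berry–Esseen errors. Positivity of `k √k / n` is required
  -- separately to exclude `k n = 0`, since `C` may vanish.
  filter_upwards [hlim0.eventually (eventually_le_nhds (show 0 < min (1 / 2) (ε / 2000) by positivity)),
    hlim1.eventually_ge_atTop (4 * C / ε), hlim1.eventually_gt_atTop 0,
    eventually_gt_atTop 0] with n h1 h2 h3 hn x
  have hn0 : (0 : ℝ) < n := by exact_mod_cast hn
  have hk1 : 1 ≤ k n := by
    by_contra h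
    have : k n = 0 := by omega
    simp [this] at h3
  have hk0 : (0 : ℝ) < k n := by exact_mod_cast hk1
  have hh1 : (k n : ℝ) / n ≤ 1 / 2 := h1.trans (min_le_left _ _)
  have hh2 : (k n : ℝ) / n ≤ ε / 2000 := h1.trans (min_le_right _ _)
  have hkn : 2 * k n ≤ n := by
    rw [div_le_iff₀ hn0] at hh1
    have : (2 * k n : ℝ) ≤ n := by linarith
    exact_mod_cast this
  have hh0 : 0 < (k n : ℝ) / n := by positivity
  have hCk : C / √(k n) ≤ ε / 4 * ((k n : ℝ) / n) := by
    rw [div_le_iff₀ (by positivity)]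
    rw [div_le_iff₀ hε] at h2
    calc C ≤ (k n * √(k n) / n * ε) / 4 := by linarith
      _ = _ := by ring
  have hG := abs_cdf_stdGaussian_scale_sub_le x hh0.le hh1
  obtain ⟨hp, hm⟩ := happ n (k n) hk1 hkn x
  have hsq : 1000 * ((k n : ℝ) / n) ^ 2 ≤ ε / 2 * ((k n : ℝ) / n) := by nlinarith
  rw [abs_le] at hG hp hm ⊢
  constructor <;> linarith [hG.1, hG.2, hp.1, hp.2, hm.1, hm.2]
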